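/- Let $K$ be a field of positive characteristic $p$ and let $L$ be a Lie algebra over $K$ (of arbitrary dimension, not necessarily restricted). Let $S(L)$ be the symmetric algebra of the vector space $L$, with the Poisson bracket that extends the Lie bracket of $L$ by bilinearity and the Leibniz rule $\{ab,c\}=a\{b,c\}+b\{a,c\}$, and let $\mathbf{s}(L)=S(L)/(v^p \mid v\in L)$ be the truncated symmetric Poisson algebra with the induced bracket. For a Poisson algebra $R$ over $K$ put $\delta_0(R)=R$, $\delta_{n+1}(R)=\{\delta_n(R),\delta_n(R)\}$ (the linear span of the brackets) and $\tilde\delta_0(R)=R$, $\tilde\delta_{n+1}(R)=\{\tilde\delta_n(R),\tilde\delta_n(R)\}\cdot R$ (the ideal of the commutative algebra $R$ generated by the brackets). The algebra $R$ is called solvable if $\delta_s(R)=0$ for some $s$, and strongly solvable if $\tilde\delta_s(R)=0$ for some $s$. Theorem. If $p\ge 3$, the following conditions are equivalent: (1) $\mathbf{s}(L)$ is strongly solvable; (2) $\mathbf{s}(L)$ is solvable; (3) $L$ is solvable and $\dim_K L^2<\infty$, where $L^2=[L,L]$. If $p=2$, conditions (1) and (3) are equivalent. -/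

import Mathlib

/-- A Poisson algebra over `K`: a commutative associative unital `K`-algebra with a second,
`K`-bilinear operation which is a Lie bracket and is related to the product by the Leibniz rule. -/
class PoissonAlgebra (K A : Type*) [CommRing K] [CommRing A] [Algebra K A] where
  /-- The Poisson bracket `{a, b}`. -/
  bracket : A →ₗ[K] A →ₗ[K] A
  bracket_self : ∀ a : A, bracket a a = 0
  jacobi : ∀ a b c : A,
    bracket a (bracket b c) + bracket b (bracket c a) + bracket c (bracket a b) = 0
  leibniz : ∀ a b c : A, bracket (a * b) c = a * bracket b c + b * bracket a c

namespace PoissonAlgebra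

variable (K A : Type*) [CommRing K] [CommRing A] [Algebra K A] [PoissonAlgebra K A]

/-- The derived series `δ₀ = A`, `δₙ₊₁ = {δₙ, δₙ}` (the linear span of all brackets of two
elements of `δₙ`). -/
def derivedSeries : ℕ → Submodule K A
  | 0 => ⊤
  | n + 1 => Submodule.span K
      {c | ∃ a ∈ derivedSeries n, ∃ b ∈ derivedSeries n, c = bracket (K := K) a b}

/-- The upper derived series `δ̃₀ = A`, `δ̃ₙ₊₁ = {δ̃ₙ, δ̃ₙ} · A` (the ideal of the commutative
algebra `A` generated by all brackets of two elements of `δ̃ₙ`). -/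
def upperDerivedSeries : ℕ → Ideal A
  | 0 => ⊤
  | n + 1 => Ideal.span
      {c | ∃ a ∈ upperDerivedSeries n, ∃ b ∈ upperDerivedSeries n, c = bracket (K := K) a b}

/-- A Poisson algebra is solvable if its derived series reaches zero. -/
def IsSolvable : Prop := ∃ s : ℕ, derivedSeries K A s = ⊥

/-- A Poisson algebra is strongly solvable if its upper derived series reaches zero. -/
def IsStronglySolvable : Prop := ∃ s : ℕ, upperDerivedSeries K A s = ⊥

end PoissonAlgebra

namespace SymmetricAlgebra

section Derivations

variable {K M : Type*} [CommRing K] [AddCommGroup M] [Module K M]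

/-- The algebra map `a ↦ a + ε D(a)` into the dual numbers over the symmetric algebra which is
determined by the values `f` of `D` on generators. -/
noncomputable def dualLift (f : M →ₗ[K] SymmetricAlgebra K M) :
    SymmetricAlgebra K M →ₐ[K] TrivSqZeroExt (SymmetricAlgebra K M) (SymmetricAlgebra K M) :=
  lift ((TrivSqZeroExt.inlAlgHom K (SymmetricAlgebra K M) (SymmetricAlgebra K M)).toLinearMap ∘ₗ
      ι K M + (TrivSqZeroExt.inrHom (SymmetricAlgebra K M) (SymmetricAlgebra K M)).restrictScalars K
      ∘ₗ f)

theorem dualLift_ι (f : M →ₗ[K] SymmetricAlgebra K M) (x : M) :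
    dualLift f (ι K M x) = TrivSqZeroExt.inl (ι K M x) + TrivSqZeroExt.inr (f x) := by
  simp [dualLift]

theorem fst_dualLift (f : M →ₗ[K] SymmetricAlgebra K M) (a : SymmetricAlgebra K M) :
    (dualLift f a).fst = a := by
  have h : (TrivSqZeroExt.fstHom K (SymmetricAlgebra K M) (SymmetricAlgebra K M)).comp
      (dualLift f) = AlgHom.id K _ := by
    apply algHom_ext
    ext x
    simp [dualLift_ι]
  exact congr($h a)

/-- The unique derivation of the symmetric algebra with prescribed values on generators. -/
noncomputable def derivation (f : M →ₗ[K] SymmetricAlgebra K M) :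
    Derivation K (SymmetricAlgebra K M) (SymmetricAlgebra K M) :=
  Derivation.mk'
    ((TrivSqZeroExt.sndHom (SymmetricAlgebra K M) (SymmetricAlgebra K M)).restrictScalars K ∘ₗ
      (dualLift f).toLinearMap)
    (by intro a b; simp [fst_dualLift, mul_comm])

theorem derivation_ι (f : M →ₗ[K] SymmetricAlgebra K M) (x : M) :
    derivation f (ι K M x) = f x := by
  simp [derivation, dualLift_ι]

theorem derivation_ext {D E : Derivation K (SymmetricAlgebra K M) (SymmetricAlgebra K M)}
    (h : ∀ x, D (ι K M x) = E (ι K M x)) : D = E := by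
  ext a
  induction a using SymmetricAlgebra.induction with
  | algebraMap r => simp
  | ι x => exact h x
  | mul a b ha hb => simp [ha, hb]
  | add a b ha hb => simp [ha, hb]

/-- `derivation` as a linear map. -/
noncomputable def derivationₗ : (M →ₗ[K] SymmetricAlgebra K M) →ₗ[K]
    Derivation K (SymmetricAlgebra K M) (SymmetricAlgebra K M) where
  toFun := derivation
  map_add' f g := derivation_ext fun x => by simp [derivation_ι]
  map_smul' c f := derivation_ext fun x => by simp [derivation_ι]

end Derivations

section Poisson

variable (K L : Type*) [CommRing K] [LieRing L] [LieAlgebra K L]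

/-- For `x` in `L`, the derivation `{x, ·}` of the symmetric algebra that sends each generator `y`
in `L` to `[x, y]`. -/
noncomputable def adDerivation :
    L →ₗ[K] Derivation K (SymmetricAlgebra K L) (SymmetricAlgebra K L) where
  toFun x := derivation (ι K L ∘ₗ (LieAlgebra.ad K L x : L →ₗ[K] L))
  map_add' x y := derivation_ext fun z => by simp [derivation_ι]
  map_smul' c x := derivation_ext fun z => by simp [derivation_ι]

theorem adDerivation_ι (x y : L) : adDerivation K L x (ι K L y) = ι K L ⁅x, y⁆ := by
  simp [adDerivation, derivation_ι]

/-- The Poisson bracket of the symmetric algebra of a Lie algebra: for fixed `b`, the map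
`{·, b}` is the derivation that sends each generator `x` in `L` to `{x, b}`. -/
noncomputable def poissonBracket :
    SymmetricAlgebra K L →ₗ[K] SymmetricAlgebra K L →ₗ[K] SymmetricAlgebra K L where
  toFun a :=
    { toFun := fun b => derivation
        { toFun := fun x => adDerivation K L x b
          map_add' := fun x y => by simp
          map_smul' := fun c x => by simp } a
      map_add' := fun b c => by
        rw [← Derivation.add_apply]
        congr 1
        exact derivation_ext fun x => by simp [derivation_ι]
      map_smul' := fun r b => by
        rw [RingHom.id_apply, ← Derivation.smul_apply]
        congr 1
        exact derivation_ext fun x => by simp [derivation_ι] }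
  map_add' a b := by ext c; simp
  map_smul' r a := by ext c; simp

variable {K L}

theorem poissonBracket_ι_left (x : L) (b : SymmetricAlgebra K L) :
    poissonBracket K L (ι K L x) b = adDerivation K L x b := by
  simp [poissonBracket, derivation_ι]

theorem poissonBracket_ι_ι (x y : L) :
    poissonBracket K L (ι K L x) (ι K L y) = ι K L ⁅x, y⁆ := by
  rw [poissonBracket_ι_left, adDerivation_ι]

theorem poissonBracket_mul_left (a b c : SymmetricAlgebra K L) :
    poissonBracket K L (a * b) c =
      a * poissonBracket K L b c + b * poissonBracket K L a c := by
  simp [poissonBracket]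

theorem poissonBracket_algebraMap_left (r : K) (b : SymmetricAlgebra K L) :
    poissonBracket K L (algebraMap K _ r) b = 0 := by
  simp [poissonBracket]

theorem poissonBracket_algebraMap_right (a : SymmetricAlgebra K L) (r : K) :
    poissonBracket K L a (algebraMap K _ r) = 0 := by
  induction a using SymmetricAlgebra.induction with
  | algebraMap s => simp [poissonBracket_algebraMap_left]
  | ι x => simp [poissonBracket_ι_left]
  | mul a b ha hb => simp [poissonBracket_mul_left, ha, hb]
  | add a b ha hb => simp [ha, hb]

theorem poissonBracket_mul_right (a b c : SymmetricAlgebra K L) :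
    poissonBracket K L a (b * c) =
      b * poissonBracket K L a c + c * poissonBracket K L a b := by
  induction a using SymmetricAlgebra.induction with
  | algebraMap s => simp [poissonBracket_algebraMap_left]
  | ι x => simp [poissonBracket_ι_left]
  | mul a a' ha hb => rw [poissonBracket_mul_left, ha, hb, poissonBracket_mul_left,
      poissonBracket_mul_left]; ring
  | add a a' ha hb => rw [map_add, LinearMap.add_apply, ha, hb, LinearMap.add_apply,
      LinearMap.add_apply]; ring

theorem poissonBracket_skew (a b : SymmetricAlgebra K L) :
    poissonBracket K L a b = -poissonBracket K L b a := by
  induction a using SymmetricAlgebra.induction with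
  | algebraMap s => simp [poissonBracket_algebraMap_left, poissonBracket_algebraMap_right]
  | ι x =>
    induction b using SymmetricAlgebra.induction with
    | algebraMap s => simp [poissonBracket_algebraMap_left, poissonBracket_algebraMap_right]
    | ι y => rw [poissonBracket_ι_ι, poissonBracket_ι_ι, ← map_neg, lie_skew]
    | mul b c hb hc => rw [poissonBracket_mul_left, poissonBracket_mul_right, hb, hc]; ring
    | add b c hb hc => simp only [map_add, LinearMap.add_apply, hb, hc]; ring
  | mul a a' ha hb => rw [poissonBracket_mul_left, poissonBracket_mul_right, ha, hb]; ring
  | add a a' ha hb => simp only [map_add, LinearMap.add_apply, ha, hb]; ring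

theorem poissonBracket_self (a : SymmetricAlgebra K L) : poissonBracket K L a a = 0 := by
  induction a using SymmetricAlgebra.induction with
  | algebraMap s => simp [poissonBracket_algebraMap_left]
  | ι x => simp [poissonBracket_ι_ι]
  | mul a b ha hb =>
    simp only [poissonBracket_mul_left, poissonBracket_mul_right, ha, hb]
    rw [poissonBracket_skew b a]; ring
  | add a b ha hb =>
    simp only [map_add, LinearMap.add_apply, ha, hb]
    rw [poissonBracket_skew b a]; ring

theorem poissonBracket_jacobi (a b c : SymmetricAlgebra K L) :
    poissonBracket K L a (poissonBracket K L b c) + poissonBracket K L b (poissonBracket K L c a) +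
      poissonBracket K L c (poissonBracket K L a b) = 0 := by
  induction a using SymmetricAlgebra.induction with
  | algebraMap s => simp [poissonBracket_algebraMap_left, poissonBracket_algebraMap_right]
  | ι x =>
    induction b using SymmetricAlgebra.induction with
    | algebraMap s => simp [poissonBracket_algebraMap_left, poissonBracket_algebraMap_right]
    | ι y =>
      induction c using SymmetricAlgebra.induction with
      | algebraMap s => simp [poissonBracket_algebraMap_left, poissonBracket_algebraMap_right]
      | ι z => simp only [poissonBracket_ι_ι, ← map_add, lie_jacobi, map_zero]
      | mul c c' h h' =>
        simp only [poissonBracket_mul_left, poissonBracket_mul_right, map_add] at h h' ⊢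
        have e1 := poissonBracket_skew c (ι K L x)
        have e2 := poissonBracket_skew c' (ι K L x)
        rw [e1] at h ⊢
        rw [e2] at h' ⊢
        linear_combination c * h' + c' * h
      | add c c' h h' =>
        simp only [map_add, LinearMap.add_apply] at h h' ⊢
        linear_combination h + h'
    | mul b b' h h' =>
      simp only [poissonBracket_mul_left, poissonBracket_mul_right, map_add] at h h' ⊢
      have e1 := poissonBracket_skew (ι K L x) b
      have e2 := poissonBracket_skew (ι K L x) b'
      have e3 := poissonBracket_skew c b
      have e4 := poissonBracket_skew c b'
      rw [e1] at h ⊢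
      rw [e2] at h' ⊢
      rw [e3, e4]
      linear_combination b * h' + b' * h
    | add b b' h h' =>
      simp only [map_add, LinearMap.add_apply] at h h' ⊢
      linear_combination h + h'
  | mul a a' h h' =>
    simp only [poissonBracket_mul_left, poissonBracket_mul_right, map_add] at h h' ⊢
    have e1 := poissonBracket_skew c a
    have e2 := poissonBracket_skew c a'
    have e3 := poissonBracket_skew b a
    have e4 := poissonBracket_skew b a'
    rw [e1] at h ⊢
    rw [e2] at h' ⊢
    rw [e3, e4]
    linear_combination a * h' + a' * h
  | add a a' h h' =>
    simp only [map_add, LinearMap.add_apply] at h h' ⊢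
    linear_combination h + h'

/-- The symmetric Poisson algebra `S(L)` of a Lie algebra `L`. -/
noncomputable instance instPoissonAlgebra : PoissonAlgebra K (SymmetricAlgebra K L) where
  bracket := poissonBracket K L
  bracket_self := poissonBracket_self
  jacobi := poissonBracket_jacobi
  leibniz := poissonBracket_mul_left

end Poisson

end SymmetricAlgebra

section Truncated

variable (K L : Type*) [CommRing K] [LieRing L] [LieAlgebra K L] (p : ℕ)

/-- The ideal of `S(L)` generated by the powers `v ^ p`, where `v` runs over `L`. -/
def truncationIdeal : Ideal (SymmetricAlgebra K L) :=
  Ideal.span (Set.range fun v : L => SymmetricAlgebra.ι K L v ^ p)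

/-- The truncated symmetric algebra `s(L) = S(L) / (v ^ p | v ∈ L)`. -/
abbrev TruncatedSymmetricAlgebra : Type _ := SymmetricAlgebra K L ⧸ truncationIdeal K L p

namespace TruncatedSymmetricAlgebra

variable {K L} [CharP K p]

theorem bracket_pow (v : L) (u : SymmetricAlgebra K L) :
    SymmetricAlgebra.poissonBracket K L (SymmetricAlgebra.ι K L v ^ p) u = 0 := by
  have h : ∀ n : ℕ, SymmetricAlgebra.poissonBracket K L (SymmetricAlgebra.ι K L v ^ n) u =
      n * (SymmetricAlgebra.ι K L v ^ (n - 1) *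
        SymmetricAlgebra.poissonBracket K L (SymmetricAlgebra.ι K L v) u) := by
    intro n
    induction n with
    | zero =>
      have := SymmetricAlgebra.poissonBracket_algebraMap_left (1 : K) u
      simpa using this
    | succ n ih =>
      rw [pow_succ, SymmetricAlgebra.poissonBracket_mul_left, ih]
      rcases n with _ | n
      · simp
      · simp only [Nat.add_sub_cancel, pow_succ]
        push_cast
        ring
  have hp : (p : SymmetricAlgebra K L) = 0 := by
    rw [← map_natCast (algebraMap K (SymmetricAlgebra K L)), CharP.cast_eq_zero, map_zero]
  rw [h, hp, zero_mul]

theorem bracket_mem_left {a : SymmetricAlgebra K L} (ha : a ∈ truncationIdeal K L p)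
    (u : SymmetricAlgebra K L) :
    SymmetricAlgebra.poissonBracket K L a u ∈ truncationIdeal K L p := by
  induction ha using Submodule.span_induction with
  | mem x hx =>
    obtain ⟨v, rfl⟩ := hx
    simp [bracket_pow]
  | zero => simp
  | add x y _ _ hx hy => simpa using add_mem hx hy
  | smul r x hx h =>
    rw [smul_eq_mul, SymmetricAlgebra.poissonBracket_mul_left]
    exact add_mem (Ideal.mul_mem_left _ _ h) (Ideal.mul_mem_right _ _ hx)

theorem mk_bracket_eq {a a' b b' : SymmetricAlgebra K L}
    (ha : Ideal.Quotient.mk (truncationIdeal K L p) a = Ideal.Quotient.mk _ a')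
    (hb : Ideal.Quotient.mk (truncationIdeal K L p) b = Ideal.Quotient.mk _ b') :
    Ideal.Quotient.mk (truncationIdeal K L p) (SymmetricAlgebra.poissonBracket K L a b) =
      Ideal.Quotient.mk _ (SymmetricAlgebra.poissonBracket K L a' b') := by
  rw [Ideal.Quotient.eq] at ha hb ⊢
  have h : SymmetricAlgebra.poissonBracket K L a b - SymmetricAlgebra.poissonBracket K L a' b' =
      SymmetricAlgebra.poissonBracket K L (a - a') b -
        SymmetricAlgebra.poissonBracket K L (b - b') a' := by
    rw [SymmetricAlgebra.poissonBracket_skew (b - b') a']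
    simp only [map_sub, LinearMap.sub_apply]
    ring
  rw [h]
  exact sub_mem (bracket_mem_left p ha b) (bracket_mem_left p hb a')

/-- The Poisson bracket of `s(L)`, induced by that of `S(L)`. -/
noncomputable def bracket : TruncatedSymmetricAlgebra K L p →ₗ[K]
    TruncatedSymmetricAlgebra K L p →ₗ[K] TruncatedSymmetricAlgebra K L p :=
  LinearMap.mk₂ K
    (fun a b => Quotient.liftOn₂' a b
      (fun a b => Ideal.Quotient.mk (truncationIdeal K L p)
        (SymmetricAlgebra.poissonBracket K L a b))
      (fun _ _ _ _ ha hb => mk_bracket_eq p (Quotient.sound' ha) (Quotient.sound' hb)))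
    (fun a a' b => by
      obtain ⟨a, rfl⟩ := Ideal.Quotient.mk_surjective a
      obtain ⟨a', rfl⟩ := Ideal.Quotient.mk_surjective a'
      obtain ⟨b, rfl⟩ := Ideal.Quotient.mk_surjective b
      exact congrArg (Ideal.Quotient.mk (truncationIdeal K L p))
        (LinearMap.map_add₂ (SymmetricAlgebra.poissonBracket K L) a a' b))
    (fun r a b => by
      obtain ⟨a, rfl⟩ := Ideal.Quotient.mk_surjective a
      obtain ⟨b, rfl⟩ := Ideal.Quotient.mk_surjective b
      exact congrArg (Ideal.Quotient.mk (truncationIdeal K L p))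
        (LinearMap.map_smul₂ (SymmetricAlgebra.poissonBracket K L) r a b))
    (fun a b b' => by
      obtain ⟨a, rfl⟩ := Ideal.Quotient.mk_surjective a
      obtain ⟨b, rfl⟩ := Ideal.Quotient.mk_surjective b
      obtain ⟨b', rfl⟩ := Ideal.Quotient.mk_surjective b'
      exact congrArg (Ideal.Quotient.mk (truncationIdeal K L p))
        (map_add (SymmetricAlgebra.poissonBracket K L a) b b'))
    (fun r a b => by
      obtain ⟨a, rfl⟩ := Ideal.Quotient.mk_surjective a
      obtain ⟨b, rfl⟩ := Ideal.Quotient.mk_surjective b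
      exact congrArg (Ideal.Quotient.mk (truncationIdeal K L p))
        (map_smul (SymmetricAlgebra.poissonBracket K L a) r b))

theorem bracket_mk (a b : SymmetricAlgebra K L) :
    bracket p (Ideal.Quotient.mk (truncationIdeal K L p) a)
      (Ideal.Quotient.mk (truncationIdeal K L p) b) =
      Ideal.Quotient.mk (truncationIdeal K L p) (SymmetricAlgebra.poissonBracket K L a b) :=
  rfl

/-- The truncated symmetric Poisson algebra `s(L)` of a Lie algebra in characteristic `p`. -/
noncomputable instance instPoissonAlgebra :
    PoissonAlgebra K (TruncatedSymmetricAlgebra K L p) where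
  bracket := bracket p
  bracket_self a := by
    obtain ⟨a, rfl⟩ := Ideal.Quotient.mk_surjective a
    rw [bracket_mk, SymmetricAlgebra.poissonBracket_self, map_zero]
  jacobi a b c := by
    obtain ⟨a, rfl⟩ := Ideal.Quotient.mk_surjective a
    obtain ⟨b, rfl⟩ := Ideal.Quotient.mk_surjective b
    obtain ⟨c, rfl⟩ := Ideal.Quotient.mk_surjective c
    simp only [bracket_mk, ← map_add, SymmetricAlgebra.poissonBracket_jacobi, map_zero]
  leibniz a b c := by
    obtain ⟨a, rfl⟩ := Ideal.Quotient.mk_surjective a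
    obtain ⟨b, rfl⟩ := Ideal.Quotient.mk_surjective b
    obtain ⟨c, rfl⟩ := Ideal.Quotient.mk_surjective c
    rw [← map_mul, bracket_mk, bracket_mk, bracket_mk, ← map_mul, ← map_mul, ← map_add,
      SymmetricAlgebra.poissonBracket_mul_left]

end TruncatedSymmetricAlgebra

end Truncated

/-! Sufficiency of (3). Let `J` be the ideal of `s(L)` generated by `L²`. It contains all brackets,
and it is nilpotent: finitely many generators, each with vanishing `p`-th power. Modulo `J ^ 2` the
upper derived series follows the derived series of `L`, so it enters `J ^ 2` after finitely many
steps; from there each bracket gains a power of `J` (`isStronglySolvable_of_chain`).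

Necessity. Solvability passes to `L` since `L` embeds in `s(L)`. To bound `dim L²`, one shows that
the `n`-th derived term is large and uses that a product of linearly independent elements of `L` is
nonzero in `s(L)`. The upper series contains the power `2 ^ n - 1` of the commutator ideal
(`commutatorIdeal_pow_le`), which settles strong solvability for every `p`.

The ordinary series is not made of ideals, and two steps replace this bound. With `2` invertible,
`δₙ` contains elements `x * a + x ^ 2 * c` for every `a` in a power of the ideal generated by `{x,
A}` (`adIdeal_pow_le_leadingCoeff`); this forces each `ad x` to have finite rank. Centralizers of
finite sets then have finite codimension, so an infinite-dimensional `L²` would yield arbitrarily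
many mutually commuting pairs with independent brackets (`LieAlgebra.exists_commuting_pairs`), and
the product of `2 ^ n - 1` such brackets lies in `δₙ` (`prod_bracket_mem_derivedSeries`). -/

namespace PoissonAlgebra

/-! ### Bracket identities and a lower bound for the upper derived series. -/

section General

variable {K A : Type*} [CommRing K] [CommRing A] [Algebra K A] [PoissonAlgebra K A]

theorem bracket_skew (a b : A) : bracket (K := K) a b = -bracket (K := K) b a := by
  have h := bracket_self (K := K) (a + b)
  simp only [map_add, LinearMap.add_apply, bracket_self, zero_add, add_zero] at h
  exact eq_neg_of_add_eq_zero_right h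

theorem leibniz_right (a b c : A) :
    bracket (K := K) a (b * c) = b * bracket (K := K) a c + c * bracket (K := K) a b := by
  rw [bracket_skew, leibniz, bracket_skew a c, bracket_skew a b]
  ring

theorem bracket_one_left (a : A) : bracket (K := K) 1 a = 0 := by
  have h := leibniz (K := K) 1 1 a
  simpa using h

theorem bracket_one_right (a : A) : bracket (K := K) a 1 = 0 := by
  rw [bracket_skew, bracket_one_left, neg_zero]

theorem bracket_algebraMap_left (r : K) (a : A) :
    bracket (K := K) (algebraMap K A r) a = 0 := by
  rw [Algebra.algebraMap_eq_smul_one, map_smul, LinearMap.smul_apply, bracket_one_left, smul_zero]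

theorem bracket_algebraMap_right (a : A) (r : K) :
    bracket (K := K) a (algebraMap K A r) = 0 := by
  rw [bracket_skew, bracket_algebraMap_left, neg_zero]

theorem bracket_mem_derivedSeries {n : ℕ} {a b : A} (ha : a ∈ derivedSeries K A n)
    (hb : b ∈ derivedSeries K A n) : bracket (K := K) a b ∈ derivedSeries K A (n + 1) :=
  Submodule.subset_span ⟨a, ha, b, hb, rfl⟩

theorem bracket_mem_upperDerivedSeries {n : ℕ} {a b : A} (ha : a ∈ upperDerivedSeries K A n)
    (hb : b ∈ upperDerivedSeries K A n) :
    bracket (K := K) a b ∈ upperDerivedSeries K A (n + 1) :=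
  Ideal.subset_span ⟨a, ha, b, hb, rfl⟩

theorem derivedSeries_le_upperDerivedSeries (n : ℕ) :
    derivedSeries K A n ≤ (upperDerivedSeries K A n).restrictScalars K := by
  induction n with
  | zero => exact fun _ _ => Submodule.mem_top
  | succ n ih =>
    refine Submodule.span_le.2 ?_
    rintro _ ⟨a, ha, b, hb, rfl⟩
    exact bracket_mem_upperDerivedSeries (ih ha) (ih hb)

theorem IsStronglySolvable.isSolvable (h : IsStronglySolvable K A) : IsSolvable K A := by
  obtain ⟨s, hs⟩ := h
  refine ⟨s, eq_bot_iff.2 fun a ha => ?_⟩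
  have := derivedSeries_le_upperDerivedSeries s ha
  rw [hs] at this
  exact this

variable (K A) in
/-- The ideal generated by all brackets. -/
def commutatorIdeal : Ideal A := Ideal.span {c | ∃ a b : A, c = bracket (K := K) a b}

/-- Each term is an ideal, so `a * x` and `b * y` stay in it; inclusion-exclusion over the four
brackets of `a` or `a * x` with `b` or `b * y` isolates `a * b * {x, y}`. -/
theorem upperDerivedSeries_mul_le (n : ℕ) :
    upperDerivedSeries K A n * upperDerivedSeries K A n * commutatorIdeal K A ≤
      upperDerivedSeries K A (n + 1) := by
  rw [Ideal.mul_le]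
  intro r hr s hs
  induction hs using Submodule.span_induction with
  | zero => simp
  | add s t _ _ hs ht => rw [mul_add]; exact add_mem hs ht
  | smul c s _ hs => rw [smul_eq_mul, mul_left_comm]; exact Ideal.mul_mem_left _ _ hs
  | mem s hs =>
    obtain ⟨x, y, rfl⟩ := hs
    induction hr using Submodule.mul_induction_on' with
    | add r _ t _ hr ht => rw [add_mul]; exact add_mem hr ht
    | mem_mul_mem a ha b hb =>
      have h1 : bracket (K := K) (a * x) (b * y) ∈ upperDerivedSeries K A (n + 1) :=
        bracket_mem_upperDerivedSeries (Ideal.mul_mem_right _ _ ha) (Ideal.mul_mem_right _ _ hb)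
      have h2 : bracket (K := K) a b ∈ upperDerivedSeries K A (n + 1) :=
        bracket_mem_upperDerivedSeries ha hb
      have h3 : bracket (K := K) (a * x) b ∈ upperDerivedSeries K A (n + 1) :=
        bracket_mem_upperDerivedSeries (Ideal.mul_mem_right _ _ ha) hb
      have h4 : bracket (K := K) a (b * y) ∈ upperDerivedSeries K A (n + 1) :=
        bracket_mem_upperDerivedSeries ha (Ideal.mul_mem_right _ _ hb)
      have e : a * b * bracket (K := K) x y = bracket (K := K) (a * x) (b * y) -
          y * bracket (K := K) (a * x) b - x * bracket (K := K) a (b * y) +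
          x * y * bracket (K := K) a b := by
        simp only [leibniz, leibniz_right]
        ring
      rw [e]
      exact add_mem (sub_mem (sub_mem h1 (Ideal.mul_mem_left _ _ h3)) (Ideal.mul_mem_left _ _ h4))
        (Ideal.mul_mem_left _ _ h2)

theorem two_pow_succ_sub_one (n : ℕ) : 2 ^ (n + 1) - 1 = (2 ^ n - 1) + (2 ^ n - 1) + 1 := by
  have := Nat.one_le_two_pow (n := n)
  omega

/-- The exponents obey `e (n + 1) = 2 * e n + 1`: two factors from the previous term and one new
commutator. -/
theorem commutatorIdeal_pow_le (n : ℕ) :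
    commutatorIdeal K A ^ (2 ^ n - 1) ≤ upperDerivedSeries K A n := by
  induction n with
  | zero => exact le_top
  | succ n ih =>
    rw [two_pow_succ_sub_one, pow_succ, pow_add]
    exact (Ideal.mul_mono_left (Ideal.mul_mono ih ih)).trans (upperDerivedSeries_mul_le n)

/-! ### Leading coefficients in the ordinary derived series. -/

variable (K) in
/-- The ideal generated by the brackets with a fixed element. -/
def adIdeal (x : A) : Ideal A := Ideal.span (Set.range (bracket (K := K) x))

variable (K) in
/-- The coefficients `a` for which some `x * a + x ^ 2 * c` lies in the `n`-th derived term. -/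
def leadingCoeff (x : A) (n : ℕ) : Submodule K A where
  carrier := {a | ∃ c, x * a + x ^ 2 * c ∈ derivedSeries K A n}
  zero_mem' := ⟨0, by simp⟩
  add_mem' := by
    rintro a b ⟨c, hc⟩ ⟨d, hd⟩
    exact ⟨c + d, by convert add_mem hc hd using 1; ring⟩
  smul_mem' := by
    rintro r a ⟨c, hc⟩
    refine ⟨r • c, ?_⟩
    convert Submodule.smul_mem _ r hc using 1
    simp [smul_add]

/-- Since `{x, x} = 0`, bracketing two elements divisible by `x` leaves, modulo `x ^ 2`, only `x`
times the Wronskian of `a` and `b` for the derivation `{x, ·}`. -/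
theorem bracket_mem_leadingCoeff {x : A} {n : ℕ} {a b : A} (ha : a ∈ leadingCoeff K x n)
    (hb : b ∈ leadingCoeff K x n) :
    a * bracket (K := K) x b - b * bracket (K := K) x a ∈ leadingCoeff K x (n + 1) := by
  obtain ⟨c, hc⟩ := ha
  obtain ⟨d, hd⟩ := hb
  refine ⟨bracket (K := K) a b + (x * bracket (K := K) a d + a * bracket (K := K) x d -
    2 * d * bracket (K := K) x a) + (x * bracket (K := K) c b - b * bracket (K := K) x c +
    2 * c * bracket (K := K) x b) + (x ^ 2 * bracket (K := K) c d +
    2 * x * c * bracket (K := K) x d - 2 * x * d * bracket (K := K) x c), ?_⟩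
  convert bracket_mem_derivedSeries hc hd using 1
  simp only [map_add, LinearMap.add_apply, pow_two, leibniz, leibniz_right, bracket_self]
  rw [bracket_skew a x, bracket_skew c x]
  ring

end General

section Field

variable {K A : Type*} [Field K] [CommRing A] [Algebra K A] [PoissonAlgebra K A]

theorem adIdeal_pow_le_leadingCoeff (h2 : (2 : K) ≠ 0) (x : A) (n : ℕ) :
    ((adIdeal K x ^ (2 ^ n - 1) : Ideal A) : Set A) ⊆ leadingCoeff K x n := by
  induction n with
  | zero => exact fun a _ => ⟨0, Submodule.mem_top⟩
  | succ n ih =>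
    -- With `W` the Wronskian, `W(a, b*u*y) + W(b, a*u*y) + W(a*u, b*y) + W(b*u, a*y) = 4*a*b*u*{x,
    -- y}`. The free factor `u` is needed because `leadingCoeff` is only a `K`-subspace.
    have key : ∀ a ∈ adIdeal K x ^ (2 ^ n - 1), ∀ b ∈ adIdeal K x ^ (2 ^ n - 1), ∀ u y : A,
        a * b * u * bracket (K := K) x y ∈ leadingCoeff K x (n + 1) := by
      intro a ha b hb u y
      have m : ∀ {c : A}, c ∈ adIdeal K x ^ (2 ^ n - 1) → ∀ v, c * v ∈ leadingCoeff K x n :=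
        fun hc v => ih (Ideal.mul_mem_right _ _ hc)
      have h1 := bracket_mem_leadingCoeff (ih ha) (m hb (u * y))
      have h2' := bracket_mem_leadingCoeff (ih hb) (m ha (u * y))
      have h3 := bracket_mem_leadingCoeff (m ha u) (m hb y)
      have h4 := bracket_mem_leadingCoeff (m hb u) (m ha y)
      have h := add_mem (add_mem h1 h2') (add_mem h3 h4)
      have h4' : (4 : K) ≠ 0 := by
        rw [show (4 : K) = 2 * 2 by norm_num]
        exact mul_ne_zero h2 h2
      rw [← (leadingCoeff K x (n + 1)).smul_mem_iff h4']
      convert h using 1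
      rw [Algebra.smul_def, map_ofNat]
      simp only [leibniz_right]
      ring
    intro r hr
    rw [SetLike.mem_coe, two_pow_succ_sub_one, pow_succ, pow_add] at hr
    induction hr using Submodule.mul_induction_on' with
    | add r _ t _ hr ht => exact add_mem hr ht
    | mem_mul_mem r hr s hs =>
      have gen : ∀ u y : A, r * u * bracket (K := K) x y ∈ leadingCoeff K x (n + 1) := by
        intro u y
        induction hr using Submodule.mul_induction_on' with
        | add r _ t _ hr ht => rw [add_mul, add_mul]; exact add_mem hr ht
        | mem_mul_mem a ha b hb => exact key a ha b hb u y
      suffices ∀ u, r * u * s ∈ leadingCoeff K x (n + 1) by simpa using this 1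
      induction hs using Submodule.span_induction with
      | zero => simp
      | add s t _ _ hs ht => exact fun u => by rw [mul_add]; exact add_mem (hs u) (ht u)
      | smul c s _ hs =>
        intro u
        rw [smul_eq_mul, ← mul_assoc, mul_assoc r]
        exact hs _
      | mem s hs =>
        obtain ⟨y, rfl⟩ := hs
        exact fun u => gen u y

end Field

/-! ### Products of brackets of commuting pairs. -/

section Commuting

variable {K A : Type*} [CommRing K] [CommRing A] [Algebra K A] [PoissonAlgebra K A]

theorem bracket_prod_eq_zero {ι : Type*} (s : Finset ι) (f : ι → A) (a : A)
    (h : ∀ i ∈ s, bracket (K := K) a (f i) = 0) : bracket (K := K) a (∏ i ∈ s, f i) = 0 := by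
  classical
  induction s using Finset.induction_on with
  | empty => exact bracket_one_right a
  | insert i s hi ih =>
    rw [Finset.prod_insert hi, leibniz_right, h i (Finset.mem_insert_self _ _),
      ih fun j hj => h j (Finset.mem_insert_of_mem hj)]
    simp

theorem bracket_bracket_eq_zero {a b c : A} (hb : bracket (K := K) a b = 0)
    (hc : bracket (K := K) a c = 0) : bracket (K := K) a (bracket (K := K) b c) = 0 := by
  have h := jacobi (K := K) a b c
  rwa [bracket_skew c a, hb, hc, neg_zero, map_zero, map_zero, add_zero, add_zero] at h

/-- Split off one index `i` and halve the rest, with products `P₁`, `P₂`. As everything else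
commutes, `{P₁ * x i * u, P₂ * y i} = P₁ * P₂ * {x i, y i} * u`. The factor `u` lets the induction
carry `x i * u` and `y i` along. -/
theorem prod_bracket_mem_derivedSeries {ι : Type*} (x y : ι → A)
    (hxx : ∀ i j, i ≠ j → bracket (K := K) (x i) (x j) = 0)
    (hxy : ∀ i j, i ≠ j → bracket (K := K) (x i) (y j) = 0)
    (hyy : ∀ i j, i ≠ j → bracket (K := K) (y i) (y j) = 0) (n : ℕ) :
    ∀ (s : Finset ι), s.card = 2 ^ n - 1 → ∀ u : A,
      (∀ i ∈ s, bracket (K := K) u (x i) = 0 ∧ bracket (K := K) u (y i) = 0) →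
      (∏ i ∈ s, bracket (K := K) (x i) (y i)) * u ∈ derivedSeries K A n := by
  classical
  induction n with
  | zero => exact fun _ _ _ _ => Submodule.mem_top
  | succ n ih =>
    intro s hs u hu
    rw [two_pow_succ_sub_one] at hs
    obtain ⟨i, t, hit, rfl, ht⟩ := Finset.card_eq_succ.1 hs
    obtain ⟨s₁, hs₁t, hs₁⟩ := Finset.exists_subset_card_eq (s := t) (n := 2 ^ n - 1) (by omega)
    have hs₂ : (t \ s₁).card = 2 ^ n - 1 := by
      rw [Finset.card_sdiff_of_subset hs₁t]; omega
    have ne : ∀ j ∈ t, i ≠ j := fun j hj h => hit (h ▸ hj)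
    have hyx : ∀ j ∈ t, bracket (K := K) (y i) (x j) = 0 := fun j hj => by
      rw [bracket_skew, hxy j i (ne j hj).symm, neg_zero]
    have hut : ∀ j ∈ t, bracket (K := K) u (x j) = 0 ∧ bracket (K := K) u (y j) = 0 :=
      fun j hj => hu j (Finset.mem_insert_of_mem hj)
    have hui := hu i (Finset.mem_insert_self _ _)
    have h1 := ih s₁ hs₁ (x i * u) fun j hj => by
      have hj' := hs₁t hj
      constructor
      · rw [leibniz, (hut j hj').1, hxx i j (ne j hj')]; simp
      · rw [leibniz, (hut j hj').2, hxy i j (ne j hj')]; simp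
    have h2 := ih (t \ s₁) hs₂ (y i) fun j hj => by
      have hj' := (Finset.mem_sdiff.1 hj).1
      exact ⟨hyx j hj', hyy i j (ne j hj')⟩
    have h := bracket_mem_derivedSeries h1 h2
    have hz : ∀ a : A, (∀ j ∈ t, bracket (K := K) a (x j) = 0 ∧ bracket (K := K) a (y j) = 0) →
        ∀ r ⊆ t, bracket (K := K) a (∏ j ∈ r, bracket (K := K) (x j) (y j)) = 0 :=
      fun a ha r hr => bracket_prod_eq_zero _ _ _ fun j hj =>
        bracket_bracket_eq_zero (ha j (hr hj)).1 (ha j (hr hj)).2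
    have zx := hz (x i) fun j hj => ⟨hxx i j (ne j hj), hxy i j (ne j hj)⟩
    have zy := hz (y i) fun j hj => ⟨hyx j hj, hyy i j (ne j hj)⟩
    have zu := hz u hut
    have zz : bracket (K := K) (∏ j ∈ s₁, bracket (K := K) (x j) (y j))
        (∏ j ∈ t \ s₁, bracket (K := K) (x j) (y j)) = 0 := by
      refine bracket_prod_eq_zero _ _ _ fun k hk => ?_
      obtain ⟨hkt, hk₁⟩ := Finset.mem_sdiff.1 hk
      have nk : ∀ j ∈ s₁, k ≠ j := fun j hj h => hk₁ (h ▸ hj)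
      refine bracket_bracket_eq_zero ?_ ?_ <;>
        rw [bracket_skew, bracket_prod_eq_zero, neg_zero] <;>
        refine fun j hj => bracket_bracket_eq_zero ?_ ?_
      · exact hxx k j (nk j hj)
      · exact hxy k j (nk j hj)
      · rw [bracket_skew, hxy j k (nk j hj).symm, neg_zero]
      · exact hyy k j (nk j hj)
    convert h using 1
    rw [Finset.prod_insert hit, ← Finset.prod_sdiff hs₁t]
    have e1 := zx _ (Finset.sdiff_subset (s := t) (t := s₁))
    have e2 := zu _ (Finset.sdiff_subset (s := t) (t := s₁))
    have e3 := zy _ hs₁t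
    rw [bracket_skew] at e3
    simp only [leibniz, leibniz_right, e1, e2, zz, neg_eq_zero.1 e3, hui.2]
    ring

end Commuting

/-! ### Descent of the upper derived series along powers of a stable ideal. -/

section Stable

variable {K A : Type*} [CommRing K] [CommRing A] [Algebra K A] [PoissonAlgebra K A]

theorem bracket_mem_pow {J : Ideal A} (hJ : ∀ a, ∀ b ∈ J, bracket (K := K) a b ∈ J) (a : A)
    (k : ℕ) {b : A} (hb : b ∈ J ^ k) : bracket (K := K) a b ∈ J ^ k := by
  induction k generalizing b with
  | zero => simp
  | succ k ih =>
    rw [pow_succ] at hb ⊢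
    induction hb using Submodule.mul_induction_on' with
    | add b _ c _ hb hc => rw [map_add]; exact add_mem hb hc
    | mem_mul_mem b hb c hc =>
      rw [leibniz_right, mul_comm c]
      exact add_mem (Ideal.mul_mem_mul hb (hJ a c hc)) (Ideal.mul_mem_mul (ih hb) hc)

/-- Write `J ^ k = J ^ (k - 1) * J` and apply Leibniz: one factor stays outside while the bracket
remains in `J ^ k`. For `k = 1` the outside factor `J ^ (k - 1)` would contribute nothing. -/
theorem bracket_mem_pow_succ {J : Ideal A} (hJ : ∀ a, ∀ b ∈ J, bracket (K := K) a b ∈ J)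
    {k : ℕ} (hk : 2 ≤ k) {a b : A} (ha : a ∈ J ^ k) (hb : b ∈ J ^ k) :
    bracket (K := K) a b ∈ J ^ (k + 1) := by
  obtain ⟨k, rfl⟩ := Nat.exists_eq_add_of_le' hk
  rw [pow_succ] at ha
  induction ha using Submodule.mul_induction_on' with
  | add b _ c _ hb hc => rw [map_add]; exact add_mem hb hc
  | mem_mul_mem a ha c hc =>
    rw [leibniz]
    refine add_mem ?_ ?_
    · have h := Ideal.mul_mem_mul ha (bracket_mem_pow hJ c _ hb)
      rw [← pow_add] at h
      exact Ideal.pow_le_pow_right (by omega) h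
    · have h := Ideal.mul_mem_mul hc (bracket_mem_pow hJ a _ hb)
      rwa [← pow_succ'] at h

/-- `I 0 ^ 2` is stable under all brackets, so one may compute modulo it, where the products `I n *
I n` disappear. The shift by one is there because `I 0` already contains the first derived term. -/
theorem upperDerivedSeries_succ_le_sup {I : ℕ → Ideal A} (hI : ∀ n, I n ≤ I 0)
    (h0 : ∀ a b, bracket (K := K) a b ∈ I 0)
    (hb : ∀ n, ∀ a ∈ I n, ∀ b ∈ I n, bracket (K := K) a b ∈ I (n + 1) ⊔ I n * I n) (n : ℕ) :
    upperDerivedSeries K A (n + 1) ≤ I n ⊔ I 0 ^ 2 := by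
  have stable : ∀ a, ∀ b ∈ I 0, bracket (K := K) a b ∈ I 0 := fun a b _ => h0 a b
  induction n with
  | zero =>
    refine (Ideal.span_le.2 ?_).trans le_sup_left
    rintro _ ⟨a, -, b, -, rfl⟩
    exact h0 a b
  | succ n ih =>
    refine Ideal.span_le.2 ?_
    rintro _ ⟨c, hc, d, hd, rfl⟩
    obtain ⟨a, ha, a', ha', rfl⟩ := Submodule.mem_sup.1 (ih hc)
    obtain ⟨b, hb₁, b', hb₂, rfl⟩ := Submodule.mem_sup.1 (ih hd)
    have hle : I (n + 1) ⊔ I n * I n ≤ I (n + 1) ⊔ I 0 ^ 2 := by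
      rw [pow_two]
      exact sup_le_sup le_rfl (Ideal.mul_mono (hI n) (hI n))
    rw [map_add, LinearMap.map_add₂ _ a a' b]
    refine add_mem (add_mem (hle (hb n a ha b hb₁)) ?_) ?_
    · rw [bracket_skew]
      exact Ideal.mem_sup_right (neg_mem (bracket_mem_pow stable _ 2 ha'))
    · exact Ideal.mem_sup_right (bracket_mem_pow stable _ 2 hb₂)

theorem isStronglySolvable_of_chain {I : ℕ → Ideal A} (hI : ∀ n, I n ≤ I 0)
    (h0 : ∀ a b, bracket (K := K) a b ∈ I 0)
    (hb : ∀ n, ∀ a ∈ I n, ∀ b ∈ I n, bracket (K := K) a b ∈ I (n + 1) ⊔ I n * I n)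
    (hnil : IsNilpotent (I 0)) {n : ℕ} (hn : I n = ⊥) : IsStronglySolvable K A := by
  obtain ⟨m, hm⟩ := hnil
  have key : ∀ k, upperDerivedSeries K A (n + 1 + k) ≤ I 0 ^ (k + 2) := by
    intro k
    induction k with
    | zero => exact (upperDerivedSeries_succ_le_sup hI h0 hb n).trans (by rw [hn, bot_sup_eq])
    | succ k ih =>
      refine Ideal.span_le.2 ?_
      rintro _ ⟨a, ha, b, hb, rfl⟩
      exact bracket_mem_pow_succ (fun a b _ => h0 a b) (by omega) (ih ha) (ih hb)
  refine ⟨n + 1 + m, eq_bot_iff.2 ((key m).trans ?_)⟩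
  rw [pow_add, hm]
  simp

end Stable

end PoissonAlgebra

open PoissonAlgebra

/-! ### Generators and nonvanishing products in the truncated symmetric algebra. -/

namespace TruncatedSymmetricAlgebra

section Basic

variable (K : Type*) {L : Type*} [CommRing K] [LieRing L] [LieAlgebra K L] (p : ℕ)

/-- The canonical map from a Lie algebra to its truncated symmetric algebra. -/
noncomputable def of : L →ₗ[K] TruncatedSymmetricAlgebra K L p :=
  (Ideal.Quotient.mkₐ K (truncationIdeal K L p)).toLinearMap ∘ₗ SymmetricAlgebra.ι K L

theorem of_pow (v : L) : of K p v ^ p = 0 := by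
  change Ideal.Quotient.mk (truncationIdeal K L p) (SymmetricAlgebra.ι K L v) ^ p = 0
  rw [← map_pow]
  exact Ideal.Quotient.eq_zero_iff_mem.2 (Ideal.subset_span ⟨v, rfl⟩)

theorem adjoin_range_of :
    Algebra.adjoin K (Set.range (of K p : L → TruncatedSymmetricAlgebra K L p)) = ⊤ := by
  refine eq_top_iff.2 fun a _ => ?_
  obtain ⟨a, rfl⟩ := Ideal.Quotient.mk_surjective a
  induction a using SymmetricAlgebra.induction with
  | algebraMap r => exact Subalgebra.algebraMap_mem _ r
  | ι x => exact Algebra.subset_adjoin ⟨x, rfl⟩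
  | mul a b ha hb => rw [map_mul]; exact mul_mem (ha trivial) (hb trivial)
  | add a b ha hb => rw [map_add]; exact add_mem (ha trivial) (hb trivial)

variable {p} in
/-- The algebra map out of the truncated symmetric algebra determined by a linear map whose values
have vanishing `p`-th power. -/
noncomputable def lift {B : Type*} [CommRing B] [Algebra K B] (f : L →ₗ[K] B)
    (hf : ∀ x, f x ^ p = 0) : TruncatedSymmetricAlgebra K L p →ₐ[K] B :=
  Ideal.Quotient.liftₐ (truncationIdeal K L p) (SymmetricAlgebra.lift f) (by
    have : truncationIdeal K L p ≤ RingHom.ker (SymmetricAlgebra.lift f) := by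
      refine Ideal.span_le.2 ?_
      rintro _ ⟨v, rfl⟩
      simp [hf]
    exact fun a ha => this ha)

variable {p} in
theorem lift_of {B : Type*} [CommRing B] [Algebra K B] (f : L →ₗ[K] B)
    (hf : ∀ x, f x ^ p = 0) (x : L) : lift K f hf (of K p x) = f x :=
  SymmetricAlgebra.lift_ι_apply (f := f) x

variable [CharP K p]

theorem bracket_of_of (x y : L) :
    PoissonAlgebra.bracket (K := K) (of K p x) (of K p y) = of K p ⁅x, y⁆ :=
  congrArg (Ideal.Quotient.mk (truncationIdeal K L p)) (SymmetricAlgebra.poissonBracket_ι_ι x y)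

end Basic

section Field

variable {K L : Type*} [Field K] [LieRing L] [LieAlgebra K L] (p : ℕ) [Fact p.Prime] [CharP K p]

/-- A product of linearly independent elements is not a combination of their squares. -/
theorem prod_of_notMem_span_sq {ι : Type*} [Fintype ι] {v : ι → L} (hv : LinearIndependent K v) :
    ∏ i, of K p (v i) ∉ Ideal.span (Set.range fun i => of K p (v i) ^ 2) := by
  classical
  obtain ⟨g, hg⟩ := LinearMap.exists_leftInverse_of_injective
    (Finsupp.linearCombination K v) (LinearMap.ker_eq_bot.2 hv)
  have hgv : ∀ i, g (v i) = Finsupp.single i 1 := fun i => by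
    simpa using congr($hg (Finsupp.single i 1))
  -- Test algebra `K[X_i] / (X_i ^ 2)`: the squares die there and the squarefree monomial survives.
  -- The map sends `v i` to `X_i`, extended to `L` by the left inverse `g`.
  let S : Set (ι →₀ ℕ) := Set.range fun i => Finsupp.single i 2
  let I : Ideal (MvPolynomial ι K) := Ideal.span ((fun s => MvPolynomial.monomial s 1) '' S)
  have hX : ∀ i, (MvPolynomial.X i : MvPolynomial ι K) ^ 2 ∈ I := fun i =>
    Ideal.subset_span ⟨Finsupp.single i 2, ⟨i, rfl⟩, by simp [MvPolynomial.X_pow_eq_monomial]⟩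
  let f : L →ₗ[K] MvPolynomial ι K ⧸ I := (Ideal.Quotient.mkₐ K I).toLinearMap ∘ₗ
    Finsupp.linearCombination K (MvPolynomial.X : ι → MvPolynomial ι K) ∘ₗ g
  have hfv : ∀ i, f (v i) = Ideal.Quotient.mk I (MvPolynomial.X i) := fun i => by
    simp [f, hgv]
  -- In characteristic `p` the power of a linear form is a combination of the `X_i ^ p`, and `p ≥
  -- 2`.
  have hf : ∀ x, f x ^ p = 0 := by
    intro x
    change Ideal.Quotient.mk I (Finsupp.linearCombination K MvPolynomial.X (g x)) ^ p = 0
    rw [← map_pow, Ideal.Quotient.eq_zero_iff_mem, Finsupp.linearCombination_apply, Finsupp.sum,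
      sum_pow_char]
    refine sum_mem fun i _ => ?_
    rw [smul_pow]
    exact Submodule.smul_of_tower_mem _ _
      (Ideal.mem_of_dvd _ (pow_dvd_pow _ (Fact.out : p.Prime).two_le) (hX i))
  intro h
  have h' := Ideal.mem_map_of_mem (lift K f hf) h
  rw [Ideal.map_span, Ideal.span_eq_bot.2, Ideal.mem_bot, map_prod] at h'
  · simp only [lift_of, hfv] at h'
    rw [← map_prod, Ideal.Quotient.eq_zero_iff_mem, MvPolynomial.mem_ideal_span_monomial_image] at h'
    have e : ∏ i, (MvPolynomial.X i : MvPolynomial ι K) =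
        MvPolynomial.monomial (∑ i, Finsupp.single i 1) 1 := by
      simp [MvPolynomial.monomial_sum_one, MvPolynomial.X]
    rw [e] at h'
    obtain ⟨_, ⟨i, rfl⟩, hi⟩ := h' (∑ i, Finsupp.single i 1) (by
      rw [MvPolynomial.mem_support_iff, MvPolynomial.coeff_monomial, if_pos rfl]
      exact one_ne_zero)
    have := hi i
    simp [Finsupp.single_apply] at this
  · rintro _ ⟨_, ⟨i, rfl⟩, rfl⟩
    rw [map_pow, lift_of, hfv, ← map_pow, Ideal.Quotient.eq_zero_iff_mem]
    exact hX i

theorem prod_of_ne_zero {ι : Type*} [Fintype ι] {v : ι → L} (hv : LinearIndependent K v) :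
    ∏ i, of K p (v i) ≠ 0 :=
  fun h => prod_of_notMem_span_sq p hv (h ▸ zero_mem _)

theorem of_injective : Function.Injective (of K p : L → TruncatedSymmetricAlgebra K L p) := by
  refine (injective_iff_map_eq_zero _).2 fun x hx => ?_
  by_contra h
  refine prod_of_ne_zero (K := K) (ι := Fin 1) (v := fun _ => x) p ?_ (by simp [hx])
  exact linearIndependent_unique_iff.2 h

theorem isSolvable_of_isSolvable (h : PoissonAlgebra.IsSolvable K (TruncatedSymmetricAlgebra K L p)) :
    LieAlgebra.IsSolvable L := by
  have key : ∀ n, ∀ x ∈ LieAlgebra.derivedSeries K L n,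
      of K p x ∈ derivedSeries K (TruncatedSymmetricAlgebra K L p) n := by
    intro n
    induction n with
    | zero => exact fun _ _ => Submodule.mem_top
    | succ n ih =>
      intro x hx
      rw [LieAlgebra.derivedSeries_def, LieAlgebra.derivedSeriesOfIdeal_succ, ← LieSubmodule.mem_toSubmodule,
        LieSubmodule.lieIdeal_oper_eq_linear_span'] at hx
      induction hx using Submodule.span_induction with
      | zero => simp
      | add x y _ _ hx hy => rw [map_add]; exact add_mem hx hy
      | smul r x _ hx => rw [map_smul]; exact Submodule.smul_mem _ _ hx
      | mem x hx =>
        obtain ⟨y, hy, z, hz, rfl⟩ := hx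
        rw [← bracket_of_of]
        exact bracket_mem_derivedSeries (ih y hy) (ih z hz)
  obtain ⟨n, hn⟩ := h
  refine LieAlgebra.IsSolvable.mk (R := K) (k := n) ((LieSubmodule.eq_bot_iff _).2 fun x hx => ?_)
  have := key n x hx
  rw [hn, Submodule.mem_bot] at this
  exact of_injective p (by rw [this, map_zero])

end Field

end TruncatedSymmetricAlgebra

/-! ### Strong solvability from a solvable Lie algebra with finite-dimensional derived algebra. -/

namespace PoissonAlgebra

section StronglySolvable

variable {K L A : Type*} [CommRing K] [LieRing L] [LieAlgebra K L] [CommRing A] [Algebra K A]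
  (f : L →ₗ[K] A)

/-- The ideal generated by the image of a Lie ideal. -/
def lieIdealSpan (M : LieIdeal K L) : Ideal A :=
  Ideal.span (f '' M)

theorem apply_mem_lieIdealSpan {M : LieIdeal K L} {x : L} (hx : x ∈ M) :
    f x ∈ lieIdealSpan f M :=
  Ideal.subset_span ⟨x, hx, rfl⟩

theorem lieIdealSpan_mono {M N : LieIdeal K L} (h : M ≤ N) :
    lieIdealSpan f M ≤ lieIdealSpan f N :=
  Ideal.span_mono (Set.image_mono h)

theorem isNilpotent_lieIdealSpan {M : LieIdeal K L} (hM : M.toSubmodule.FG) {p : ℕ}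
    (hp : ∀ x, f x ^ p = 0) :
    IsNilpotent (lieIdealSpan f M) := by
  obtain ⟨S, hS⟩ := hM
  have e : lieIdealSpan f M = Ideal.span (f '' S) := by
    refine le_antisymm (Ideal.span_le.2 ?_) (Ideal.span_mono (Set.image_mono ?_))
    · rintro _ ⟨x, hx, rfl⟩
      rw [SetLike.mem_coe, ← LieSubmodule.mem_toSubmodule, ← hS] at hx
      induction hx using Submodule.span_induction with
      | zero => simp
      | add x y _ _ hx hy => rw [map_add]; exact add_mem hx hy
      | smul r x _ hx => rw [map_smul]; exact Submodule.smul_of_tower_mem _ _ hx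
      | mem x hx => exact Ideal.subset_span ⟨x, hx, rfl⟩
    · intro x hx
      rw [SetLike.mem_coe, ← LieSubmodule.mem_toSubmodule, ← hS]
      exact Submodule.subset_span hx
  have fg : (lieIdealSpan f M).FG := e ▸ Submodule.fg_span (S.finite_toSet.image _)
  rw [fg.isNilpotent_iff_le_nilradical, lieIdealSpan, Ideal.span_le]
  rintro _ ⟨x, -, rfl⟩
  exact ⟨p, hp x⟩

variable [PoissonAlgebra K A] {f}

theorem bracket_mem_lieIdealSpan (hf : ∀ x y, bracket (K := K) (f x) (f y) = f ⁅x, y⁆)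
    (hgen : Algebra.adjoin K (Set.range f) = ⊤)
    (M : LieIdeal K L) (a : A)
    {b : A} (hb : b ∈ lieIdealSpan f M) :
    bracket (K := K) a b ∈ lieIdealSpan f M := by
  induction hb using Submodule.span_induction with
  | zero => simp
  | add b c _ _ hb hc => rw [map_add]; exact add_mem hb hc
  | smul r b hb' hb =>
    rw [smul_eq_mul, leibniz_right]
    exact add_mem (Ideal.mul_mem_left _ _ hb) (Ideal.mul_mem_right _ _ hb')
  | mem b hb =>
    obtain ⟨m, hm, rfl⟩ := hb
    have ha : a ∈ Algebra.adjoin K (Set.range f) := hgen ▸ Algebra.mem_top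
    induction ha using Algebra.adjoin_induction with
    | algebraMap r => rw [bracket_algebraMap_left]; exact zero_mem _
    | mem a ha =>
      obtain ⟨x, rfl⟩ := ha
      rw [hf]
      exact apply_mem_lieIdealSpan f (lie_mem_right K L M x m hm)
    | mul a b _ _ ha hb =>
      rw [leibniz]
      exact add_mem (Ideal.mul_mem_left _ _ hb) (Ideal.mul_mem_left _ _ ha)
    | add a b _ _ ha hb => rw [map_add]; exact add_mem ha hb

theorem bracket_mem_lieIdealSpan_derived (hf : ∀ x y, bracket (K := K) (f x) (f y) = f ⁅x, y⁆)
    (hgen : Algebra.adjoin K (Set.range f) = ⊤)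
    (a b : A) :
    bracket (K := K) a b ∈ lieIdealSpan f (LieAlgebra.derivedSeries K L 1) := by
  have mem : ∀ a, a ∈ Algebra.adjoin K (Set.range f) := fun a => hgen ▸ Algebra.mem_top
  induction mem a using Algebra.adjoin_induction with
  | algebraMap r => rw [bracket_algebraMap_left]; exact zero_mem _
  | mul a c _ _ ha hc =>
    rw [leibniz]
    exact add_mem (Ideal.mul_mem_left _ _ hc) (Ideal.mul_mem_left _ _ ha)
  | add a c _ _ ha hc => rw [map_add]; exact add_mem ha hc
  | mem a ha =>
    obtain ⟨x, rfl⟩ := ha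
    induction mem b using Algebra.adjoin_induction with
    | algebraMap r => rw [bracket_algebraMap_right]; exact zero_mem _
    | mul a c _ _ ha hc =>
      rw [leibniz_right]
      exact add_mem (Ideal.mul_mem_left _ _ hc) (Ideal.mul_mem_left _ _ ha)
    | add a c _ _ ha hc => rw [map_add]; exact add_mem ha hc
    | mem b hb =>
      obtain ⟨y, rfl⟩ := hb
      rw [hf]
      exact apply_mem_lieIdealSpan f
        (LieSubmodule.lie_mem_lie (LieSubmodule.mem_top x) (LieSubmodule.mem_top y))

/-- On generators the bracket lands in `⁅M, M⁆`. When Leibniz differentiates a coefficient instead,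
the result is still in the stable ideal and is multiplied by a generator, hence lies in the square.
-/
theorem bracket_mem_lie_sup_sq (hf : ∀ x y, bracket (K := K) (f x) (f y) = f ⁅x, y⁆)
    (hgen : Algebra.adjoin K (Set.range f) = ⊤)
    (M : LieIdeal K L) {a b : A}
    (ha : a ∈ lieIdealSpan f M) (hb : b ∈ lieIdealSpan f M) :
    bracket (K := K) a b ∈ lieIdealSpan f ⁅M, M⁆ ⊔ lieIdealSpan f M * lieIdealSpan f M := by
  have sq : ∀ {c d : A}, c ∈ lieIdealSpan f M →
      d ∈ lieIdealSpan f M → c * d ∈ lieIdealSpan f ⁅M, M⁆ ⊔ lieIdealSpan f M * lieIdealSpan f M :=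
    fun hc hd => Ideal.mem_sup_right (Ideal.mul_mem_mul hc hd)
  induction ha using Submodule.span_induction with
  | zero => simp
  | add b c _ _ hb hc => rw [map_add]; exact add_mem hb hc
  | smul r a ha' ha =>
    rw [smul_eq_mul, leibniz]
    exact add_mem (Ideal.mul_mem_left _ _ ha) (sq ha' (bracket_mem_lieIdealSpan hf hgen M r hb))
  | mem a ha =>
    obtain ⟨x, hx, rfl⟩ := ha
    induction hb using Submodule.span_induction with
    | zero => simp
    | add b c _ _ hb hc => rw [map_add]; exact add_mem hb hc
    | smul r b hb' hb =>
      rw [smul_eq_mul, leibniz_right]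
      refine add_mem (Ideal.mul_mem_left _ _ hb) (sq hb' ?_)
      rw [bracket_skew]
      exact neg_mem (bracket_mem_lieIdealSpan hf hgen M r (apply_mem_lieIdealSpan f hx))
    | mem b hb =>
      obtain ⟨y, hy, rfl⟩ := hb
      rw [hf]
      exact Ideal.mem_sup_left (apply_mem_lieIdealSpan f (LieSubmodule.lie_mem_lie hx hy))

theorem isStronglySolvable_of_fg (hf : ∀ x y, bracket (K := K) (f x) (f y) = f ⁅x, y⁆)
    (hgen : Algebra.adjoin K (Set.range f) = ⊤)
    [LieAlgebra.IsSolvable L] {p : ℕ} (hp : ∀ x, f x ^ p = 0)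
    (h : (LieAlgebra.derivedSeries K L 1).toSubmodule.FG) :
    IsStronglySolvable K A := by
  obtain ⟨n, hn⟩ := LieAlgebra.IsSolvable.solvable K L
  refine isStronglySolvable_of_chain (n := n)
    (I := fun n => lieIdealSpan f (LieAlgebra.derivedSeries K L (n + 1)))
    (fun n => lieIdealSpan_mono f (LieAlgebra.derivedSeriesOfIdeal_antitone ⊤ (by omega)))
    (bracket_mem_lieIdealSpan_derived hf hgen)
    (fun n a ha b hb => by
      have h := bracket_mem_lie_sup_sq hf hgen _ ha hb
      rwa [← LieAlgebra.derivedSeriesOfIdeal_succ] at h) (isNilpotent_lieIdealSpan f h hp) ?_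
  refine eq_bot_iff.2 (Ideal.span_le.2 ?_)
  rintro _ ⟨x, hx, rfl⟩
  have := LieAlgebra.derivedSeriesOfIdeal_succ_le (R := K) (L := L) ⊤ n hx
  rw [← LieAlgebra.derivedSeries_def, hn, LieSubmodule.mem_bot] at this
  rw [this, map_zero]
  exact zero_mem _

end StronglySolvable

end PoissonAlgebra

/-! ### Independent families in subspaces of infinite dimension. -/

section LinearAlgebra

variable {K V : Type*} [Field K] [AddCommGroup V] [Module K V]

theorem Submodule.exists_mem_notMem_of_not_fg {W F : Submodule K V} (hW : ¬W.FG) (hF : F.FG) :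
    ∃ w ∈ W, w ∉ F := by
  by_contra! h
  have : FiniteDimensional K F := Module.Finite.iff_fg.2 hF
  exact hW (Module.Finite.iff_fg.1 (Submodule.finiteDimensional_of_le (S₁ := W) h))

theorem Submodule.exists_linearIndependent_cons {W : Submodule K V} (hW : ¬W.FG) {x : V}
    (hx : x ≠ 0) (N : ℕ) :
    ∃ v : Fin N → V, (∀ i, v i ∈ W) ∧ LinearIndependent K (Fin.cons x v : Fin (N + 1) → V) := by
  induction N with
  | zero => exact ⟨Fin.elim0, fun i => i.elim0, linearIndependent_finCons.2
      ⟨linearIndependent_empty_type, by simpa using hx⟩⟩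
  | succ N ih =>
    obtain ⟨v, hvW, hv⟩ := ih
    obtain ⟨w, hw, hwv⟩ := Submodule.exists_mem_notMem_of_not_fg hW
      (Submodule.fg_span (Set.finite_range (Fin.cons x v : Fin (N + 1) → V)))
    refine ⟨Fin.snoc v w, fun i => ?_, ?_⟩
    · refine Fin.lastCases ?_ (fun i => ?_) i
      · simpa using hw
      · simpa using hvW i
    · rw [Fin.cons_snoc_eq_snoc_cons]
      exact linearIndependent_finSnoc.2 ⟨hv, hwv⟩

end LinearAlgebra

/-! ### Lie algebras whose inner derivations have finite rank. -/

section Lie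

variable {K L : Type*} [Field K] [LieRing L] [LieAlgebra K L]

theorem LieAlgebra.derivedSeries_one_toSubmodule : (LieAlgebra.derivedSeries K L 1).toSubmodule =
    Submodule.span K {⁅x, y⁆ | (x : L) (y : L)} :=
  LieAlgebra.coe_derivedSeries_one_eq K L

/-- A complement `F` of `C` is finite-dimensional, so `[F, L]` is too. If `[C, C]` lay in `W`, then
`L²` would lie in `W + [F, L]`. -/
theorem LieAlgebra.exists_lie_notMem (had : ∀ x : L, (LieAlgebra.ad K L x).HasFiniteRange)
    (hL : ¬(LieAlgebra.derivedSeries K L 1).toSubmodule.FG) {C W : Submodule K L} (hC : C.CoFG)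
    (hW : W.FG) : ∃ a ∈ C, ∃ b ∈ C, ⁅a, b⁆ ∉ W := by
  by_contra! h
  obtain ⟨F, hF⟩ := C.exists_isCompl
  obtain ⟨S, rfl⟩ := Submodule.CoFG.fg_of_isCompl hF hC
  let G : Submodule K L := ⨆ s ∈ S, (LieAlgebra.ad K L s).range
  have hG : G.FG := Submodule.fg_biSup S _ fun s _ => had s
  have hFG : ∀ f ∈ Submodule.span K (S : Set L), ∀ y : L, ⁅f, y⁆ ∈ G := by
    intro f hf y
    induction hf using Submodule.span_induction with
    | zero => simp
    | add f g _ _ hf hg => rw [add_lie]; exact add_mem hf hg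
    | smul r f _ hf => rw [smul_lie]; exact Submodule.smul_mem _ _ hf
    | mem f hf =>
      exact Submodule.mem_iSup_of_mem f (Submodule.mem_iSup_of_mem hf ⟨y, rfl⟩)
  have hle : (LieAlgebra.derivedSeries K L 1).toSubmodule ≤ W ⊔ G := by
    rw [LieAlgebra.derivedSeries_one_toSubmodule, Submodule.span_le]
    rintro _ ⟨x, y, rfl⟩
    obtain ⟨a, ha, f, hf, rfl⟩ := Submodule.mem_sup.1 (hF.sup_eq_top ▸ Submodule.mem_top (x := x))
    obtain ⟨b, hb, g, hg, rfl⟩ := Submodule.mem_sup.1 (hF.sup_eq_top ▸ Submodule.mem_top (x := y))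
    rw [add_lie, lie_add a, ← lie_skew a g]
    exact add_mem (add_mem (Submodule.mem_sup_left (h a ha b hb))
      (Submodule.mem_sup_right (neg_mem (hFG g hg a)))) (Submodule.mem_sup_right (hFG f hf _))
  obtain ⟨w, hw, hw'⟩ := Submodule.exists_mem_notMem_of_not_fg hL (hW.sup hG)
  exact hw' (hle hw)

theorem LieAlgebra.exists_commuting_pairs
    (had : ∀ x : L, (LieAlgebra.ad K L x).HasFiniteRange)
    (hL : ¬(LieAlgebra.derivedSeries K L 1).toSubmodule.FG) (N : ℕ) :
    ∃ x y : Fin N → L, (∀ i j, i ≠ j → ⁅x i, x j⁆ = 0 ∧ ⁅x i, y j⁆ = 0 ∧ ⁅y i, y j⁆ = 0) ∧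
      LinearIndependent K (fun i => ⁅x i, y i⁆) := by
  induction N with
  | zero => exact ⟨Fin.elim0, Fin.elim0, fun i => i.elim0, linearIndependent_empty_type⟩
  | succ N ih =>
    obtain ⟨x, y, hxy, hli⟩ := ih
    -- The centralizer of all pairs chosen so far, a finite intersection of kernels of finite-rank
    -- maps; the next pair is taken inside it.
    let C : Submodule K L :=
      (⨅ i, (LieAlgebra.ad K L (x i)).ker) ⊓ ⨅ i, (LieAlgebra.ad K L (y i)).ker
    have hC : C.CoFG := by
      refine Submodule.CoFG.inf ?_ ?_ <;>
      · refine Submodule.CoFG.sInf_of_finite (Set.finite_range _) ?_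
        rintro _ ⟨i, rfl⟩
        exact (had _).cofg_ker
    have hCx : ∀ a ∈ C, ∀ i, ⁅x i, a⁆ = 0 := fun a ha i => (Submodule.mem_iInf _).1 ha.1 i
    have hCy : ∀ a ∈ C, ∀ i, ⁅y i, a⁆ = 0 := fun a ha i => (Submodule.mem_iInf _).1 ha.2 i
    obtain ⟨a, ha, b, hb, hab⟩ := LieAlgebra.exists_lie_notMem had hL hC
      (Submodule.fg_span (Set.finite_range fun i => ⁅x i, y i⁆))
    refine ⟨Fin.snoc x a, Fin.snoc y b, fun i j => ?_, ?_⟩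
    · have sw : ∀ {u v : L}, ⁅u, v⁆ = 0 → ⁅v, u⁆ = 0 := fun h => by rw [← lie_skew, h, neg_zero]
      refine Fin.lastCases ?_ (fun i => ?_) i <;> refine Fin.lastCases ?_ (fun j => ?_) j
      · exact fun h => (h rfl).elim
      · intro _
        simp only [Fin.snoc_last, Fin.snoc_castSucc]
        exact ⟨sw (hCx a ha j), sw (hCy a ha j), sw (hCy b hb j)⟩
      · intro _
        simp only [Fin.snoc_last, Fin.snoc_castSucc]
        exact ⟨hCx a ha i, hCx b hb i, hCy b hb i⟩
      · intro h
        simp only [Fin.snoc_castSucc]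
        exact hxy i j fun e => h (e ▸ rfl)
    · have e : (fun i => ⁅(Fin.snoc x a : Fin (N + 1) → L) i, (Fin.snoc y b : Fin (N + 1) → L) i⁆) =
          (Fin.snoc (fun i => ⁅x i, y i⁆) ⁅a, b⁆ : Fin (N + 1) → L) := by
        funext i
        refine Fin.lastCases ?_ (fun i => ?_) i <;> simp
      rw [e]
      exact linearIndependent_finSnoc.2 ⟨hli, hab⟩

end Lie

/-! ### Finite-dimensionality of the derived algebra. -/

namespace TruncatedSymmetricAlgebra

variable {K L : Type*} [Field K] [LieRing L] [LieAlgebra K L] (p : ℕ) [Fact p.Prime] [CharP K p]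

theorem fg_of_isStronglySolvable
    (h : PoissonAlgebra.IsStronglySolvable K (TruncatedSymmetricAlgebra K L p)) :
    (LieAlgebra.derivedSeries K L 1).toSubmodule.FG := by
  by_contra hL
  obtain ⟨n, hn⟩ := h
  -- Any nonzero `x` will do: it only serves as head of the family and is then discarded.
  obtain ⟨x, -, hx⟩ := Submodule.exists_mem_notMem_of_not_fg hL (Submodule.fg_bot (R := K))
  obtain ⟨v, hvL, hv⟩ := Submodule.exists_linearIndependent_cons hL hx (2 ^ n - 1)
  refine prod_of_ne_zero p (linearIndependent_finCons.1 hv).1 ?_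
  rw [← Ideal.mem_bot, ← hn]
  refine commutatorIdeal_pow_le n ?_
  have key : ∀ x ∈ (LieAlgebra.derivedSeries K L 1).toSubmodule,
      of K p x ∈ commutatorIdeal K (TruncatedSymmetricAlgebra K L p) := by
    intro x hx
    rw [LieAlgebra.derivedSeries_one_toSubmodule] at hx
    induction hx using Submodule.span_induction with
    | zero => simp
    | add x y _ _ hx hy => rw [map_add]; exact add_mem hx hy
    | smul r x _ hx => rw [map_smul]; exact Submodule.smul_of_tower_mem _ _ hx
    | mem x hx =>
      obtain ⟨y, z, rfl⟩ := hx
      exact Ideal.subset_span ⟨of K p y, of K p z, (bracket_of_of K p y z).symm⟩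
  have := Ideal.prod_mem_prod (s := Finset.univ) fun i _ => key (v i) (hvL i)
  rwa [Finset.prod_const, Finset.card_univ, Fintype.card_fin] at this

/-- If `δₙ = 0`, the leading-coefficient bound gives `x * ∏ v i = -x ^ 2 * c` with the `v i` in the
range of `ad x`. Infinite rank allows `x` and the `v i` to be independent, and then the product is
not in the ideal of their squares. -/
theorem hasFiniteRange_ad_of_isSolvable (hp : 3 ≤ p)
    (h : PoissonAlgebra.IsSolvable K (TruncatedSymmetricAlgebra K L p)) (x : L) :
    (LieAlgebra.ad K L x).HasFiniteRange := by
  by_contra hL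
  obtain ⟨n, hn⟩ := h
  have hx : x ≠ 0 := by
    rintro rfl
    refine hL ?_
    rw [map_zero]
    exact LinearMap.HasFiniteRange.zero
  have h2 : (2 : K) ≠ 0 := by
    intro h
    have h' : ((2 : ℕ) : K) = 0 := by exact_mod_cast h
    have := Nat.le_of_dvd two_pos ((CharP.cast_eq_zero_iff K p 2).1 h')
    omega
  obtain ⟨v, hvL, hv⟩ := Submodule.exists_linearIndependent_cons hL hx (2 ^ n - 1)
  have hmem : ∏ i, of K p (v i) ∈ adIdeal K (of K p x) ^ (2 ^ n - 1) := by
    have := Ideal.prod_mem_prod (s := Finset.univ) (x := fun i => of K p (v i))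
      (I := fun _ => adIdeal K (of K p x)) fun i _ => by
        obtain ⟨y, hy⟩ := hvL i
        rw [← hy]
        exact Ideal.subset_span ⟨of K p y, bracket_of_of K p x y⟩
    rwa [Finset.prod_const, Finset.card_univ, Fintype.card_fin] at this
  obtain ⟨c, hc⟩ := adIdeal_pow_le_leadingCoeff h2 (of K p x) n hmem
  rw [hn, Submodule.mem_bot] at hc
  refine prod_of_notMem_span_sq p hv ?_
  rw [Fin.prod_univ_succ]
  simp only [Fin.cons_zero, Fin.cons_succ]
  rw [eq_neg_of_add_eq_zero_left hc]
  exact neg_mem (Ideal.mul_mem_right _ _ (Ideal.subset_span ⟨0, rfl⟩))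

theorem fg_of_isSolvable (hp : 3 ≤ p)
    (h : PoissonAlgebra.IsSolvable K (TruncatedSymmetricAlgebra K L p)) :
    (LieAlgebra.derivedSeries K L 1).toSubmodule.FG := by
  by_contra hL
  obtain ⟨x, y, hxy, hli⟩ := LieAlgebra.exists_commuting_pairs
    (hasFiniteRange_ad_of_isSolvable p hp h) hL (2 ^ h.choose - 1)
  have hn := h.choose_spec
  refine prod_of_ne_zero p hli ?_
  have := prod_bracket_mem_derivedSeries (K := K) (fun i => of K p (x i)) (fun i => of K p (y i))
    (fun i j hij => by rw [bracket_of_of, (hxy i j hij).1, map_zero])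
    (fun i j hij => by rw [bracket_of_of, (hxy i j hij).2.1, map_zero])
    (fun i j hij => by rw [bracket_of_of, (hxy i j hij).2.2, map_zero]) h.choose Finset.univ
    (by simp) 1 (fun i _ => ⟨bracket_one_left _, bracket_one_left _⟩)
  rw [hn, Submodule.mem_bot, mul_one] at this
  simpa only [bracket_of_of] using this

end TruncatedSymmetricAlgebra

theorem mainTheorem3 {K L : Type*} [Field K] [LieRing L] [LieAlgebra K L]
    (p : ℕ) [Fact p.Prime] [CharP K p] :
    (3 ≤ p →
      List.TFAE
        [PoissonAlgebra.IsStronglySolvable K (TruncatedSymmetricAlgebra K L p),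
          PoissonAlgebra.IsSolvable K (TruncatedSymmetricAlgebra K L p),
          LieAlgebra.IsSolvable L ∧
            FiniteDimensional K (⁅(⊤ : LieIdeal K L), (⊤ : LieIdeal K L)⁆ : LieIdeal K L)]) ∧
    (p = 2 →
      (PoissonAlgebra.IsStronglySolvable K (TruncatedSymmetricAlgebra K L p) ↔
        LieAlgebra.IsSolvable L ∧
          FiniteDimensional K (⁅(⊤ : LieIdeal K L), (⊤ : LieIdeal K L)⁆ : LieIdeal K L))) := by
  have fin : FiniteDimensional K (⁅(⊤ : LieIdeal K L), (⊤ : LieIdeal K L)⁆ : LieIdeal K L) ↔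
      (LieAlgebra.derivedSeries K L 1).toSubmodule.FG := Module.Finite.iff_fg
  rw [fin]
  have h31 : (LieAlgebra.IsSolvable L ∧ (LieAlgebra.derivedSeries K L 1).toSubmodule.FG) →
      PoissonAlgebra.IsStronglySolvable K (TruncatedSymmetricAlgebra K L p) :=
    fun ⟨_, h⟩ => isStronglySolvable_of_fg (TruncatedSymmetricAlgebra.bracket_of_of K p)
      (TruncatedSymmetricAlgebra.adjoin_range_of K p) (TruncatedSymmetricAlgebra.of_pow K p) h
  refine ⟨fun hp => ?_, fun _ => ⟨fun h => ?_, h31⟩⟩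
  · tfae_have 1 → 2 := fun h => h.isSolvable
    tfae_have 2 → 3 := fun h => ⟨TruncatedSymmetricAlgebra.isSolvable_of_isSolvable p h,
      TruncatedSymmetricAlgebra.fg_of_isSolvable p hp h⟩
    tfae_have 3 → 1 := h31
    tfae_finish
  · exact ⟨TruncatedSymmetricAlgebra.isSolvable_of_isSolvable p h.isSolvable,
      TruncatedSymmetricAlgebra.fg_of_isStronglySolvable p h⟩
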